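/- Let $K$ be a field complete with respect to a discrete valuation $\mathrm{val}$ (normalized, with value group $\mathbb Z$) and with finite residue field of cardinality $q$. Let $R$ be its ring of integers, let $|x| = q^{-\mathrm{val}(x)}$ (any other absolute value defining the valuation, $|x|=\rho^{\mathrm{val}(x)}$ with $0<\rho<1$, gives the same objects below), let $d \ge 2$ be an integer, and endow $K^d$ with the norm $\Vert (x_1,\dots,x_d)\Vert_\infty = \max_i |x_i|$, whose closed unit ball is $R^d$. Let $\mathbb P^{d-1}(K)$ be the set of lines through the origin in $K^d$, equipped with the distance $$\mathrm{dist}(a,b) = \inf \Vert \hat a - \hat b\Vert_\infty,$$ where $\hat a$ and $\hat b$ run over the vectors of norm $1$ spanning $a$ and $b$ respectively. For $a \in \mathbb P^{d-1}(K)$ let $\mathrm{can}(a) = (a_1,\dots,a_d)$ be the unique vector of norm $1$ spanning $a$ for which there is an index $j$ with $a_j = 1$ and $|a_i| < 1$ for all $i < j$. Let $\Omega$ be the set of $1$-Lipschitz functions $f : \mathbb P^{d-1}(K) \to R^d$. With pointwise addition and the topology of uniform convergence, $\Omega$ is a compact abelian group; endow it with its Haar probability measure. For $f \in \Omega$ let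 $$N(f) = \bigcup_{a \in \mathbb P^{d-1}(K)} \{\, t \cdot \mathrm{can}(a) + f(a) : t \in R \,\} \subset K^d$$ be the associated Kakeya set. Then for almost every $f \in \Omega$ the set $N(f)$ has measure zero for the Haar measure on $K^d$ (normalized so that $R^d$ has measure $1$). -/

import Mathlib

open MeasureTheory
open scoped NormedField Valued UniformConvergence LinearAlgebra.Projectivization

namespace RandomKakeya

section Projective

variable {K : Type*} [NontriviallyNormedField K] {d : ℕ}

/-- `x` is a representative of the line `a` of sup norm `1`. -/
def IsReducedRep (a : ℙ K (Fin d → K)) (x : Fin d → K) : Prop :=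
  ‖x‖ = 1 ∧ ∃ hx : x ≠ 0, Projectivization.mk K x hx = a

/-- `x` is a reduced representative of `a` having a pivot: a coordinate equal to `1` such that all
earlier coordinates have norm less than `1`. -/
def IsCanonicalRep (a : ℙ K (Fin d → K)) (x : Fin d → K) : Prop :=
  IsReducedRep a x ∧ ∃ j : Fin d, x j = 1 ∧ ∀ i < j, ‖x i‖ < 1

theorem existsUnique_isCanonicalRep (a : ℙ K (Fin d → K)) : ∃! x, IsCanonicalRep a x := by
  classical
  refine existsUnique_of_exists_of_unique ?_ ?_
  · induction a using Projectivization.ind with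
    | h v hv =>
      have hvn : 0 < ‖v‖ := norm_pos_iff.mpr hv
      have hne : (Finset.univ.filter (fun i => ‖v i‖ = ‖v‖)).Nonempty := by
        have : Nonempty (Fin d) := by
          by_contra h
          rw [not_nonempty_iff] at h
          exact hv (Subsingleton.elim _ _)
        obtain ⟨i, hi⟩ := Finite.exists_max (fun i => ‖v i‖)
        refine ⟨i, ?_⟩
        rw [Finset.mem_filter]
        exact ⟨Finset.mem_univ i,
          le_antisymm (norm_le_pi_norm v i) ((pi_norm_le_iff_of_nonneg (norm_nonneg _)).mpr hi)⟩
      set j := (Finset.univ.filter (fun i => ‖v i‖ = ‖v‖)).min' hne with hj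
      have hjn : ‖v j‖ = ‖v‖ := by
        have := Finset.min'_mem _ hne
        rw [← hj] at this
        simpa using this
      have hj0 : v j ≠ 0 := by
        rw [← norm_pos_iff, hjn]; exact hvn
      have hw : (v j)⁻¹ • v ≠ 0 := smul_ne_zero (inv_ne_zero hj0) hv
      refine ⟨(v j)⁻¹ • v, ⟨?_, hw, ?_⟩, j, ?_, ?_⟩
      · rw [norm_smul, norm_inv, hjn, inv_mul_cancel₀ hvn.ne']
      · rw [Projectivization.mk_eq_mk_iff']
        exact ⟨_, rfl⟩
      · simp [hj0]
      · intro i hi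
        have hlt : ‖v i‖ < ‖v‖ := by
          refine lt_of_le_of_ne (norm_le_pi_norm v i) fun h => ?_
          have := Finset.min'_le (Finset.univ.filter (fun i => ‖v i‖ = ‖v‖)) i (by simpa using h)
          exact absurd hi (not_lt.mpr this)
        rw [Pi.smul_apply, norm_smul, norm_inv, hjn, inv_mul_lt_iff₀ hvn, mul_one]
        exact hlt
  · have key : ∀ x y : Fin d → K, ∀ j j' : Fin d, ∀ c : K, ‖x‖ = 1 → x j = 1 → y j' = 1 →
        (∀ i < j', ‖y i‖ < 1) → c • x = y → ¬ j < j' := by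
      intro x y j j' c hx hxj hyj hy hc hlt
      have h1 := hy j hlt
      have h2 := congrFun hc j
      have h3 := congrFun hc j'
      simp only [Pi.smul_apply, smul_eq_mul, hxj, mul_one, hyj] at h2 h3
      rw [← h2] at h1
      have h4 : ‖x j'‖ ≤ 1 := hx ▸ norm_le_pi_norm x j'
      have h5 : ‖c * x j'‖ = 1 := by rw [h3, norm_one]
      rw [norm_mul] at h5
      nlinarith [norm_nonneg c, norm_nonneg (x j')]
    rintro x y ⟨⟨hx, hx0, hxa⟩, j, hxj, hxl⟩ ⟨⟨hy, hy0, hya⟩, j', hyj, hyl⟩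
    obtain ⟨c, hc⟩ := (Projectivization.mk_eq_mk_iff' K y x hy0 hx0).mp (hya.trans hxa.symm)
    have hc0 : c ≠ 0 := by
      rintro rfl
      rw [zero_smul] at hc
      exact hy0 hc.symm
    obtain ⟨c', hc'⟩ := (Projectivization.mk_eq_mk_iff' K x y hx0 hy0).mp (hxa.trans hya.symm)
    have hjj : j = j' := le_antisymm (not_lt.mp (key y x j' j c' hy hyj hxj hxl hc'))
      (not_lt.mp (key x y j j' c hx hxj hyj hyl hc))
    subst hjj
    have h := congrFun hc j
    simp only [Pi.smul_apply, smul_eq_mul, hxj, hyj, mul_one] at h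
    rw [← hc, h, one_smul]

/-- The canonical representative of a point of the projective space. -/
noncomputable def can (a : ℙ K (Fin d → K)) : Fin d → K :=
  (existsUnique_isCanonicalRep a).choose

theorem can_spec (a : ℙ K (Fin d → K)) : IsCanonicalRep a (can a) :=
  (existsUnique_isCanonicalRep a).choose_spec.1

/-- The distance on the projective space: the infimum of the distances between representatives
lying on the unit sphere. -/
noncomputable def projDist (a b : ℙ K (Fin d → K)) : ℝ :=
  sInf {r | ∃ x y, IsReducedRep a x ∧ IsReducedRep b y ∧ r = ‖x - y‖}

theorem projDist_nonneg (a b : ℙ K (Fin d → K)) : 0 ≤ projDist a b :=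
  Real.sInf_nonneg (by rintro _ ⟨x, y, -, -, rfl⟩; exact norm_nonneg _)

theorem projDist_le {a b : ℙ K (Fin d → K)} {x y : Fin d → K} (hx : IsReducedRep a x)
    (hy : IsReducedRep b y) : projDist a b ≤ ‖x - y‖ :=
  csInf_le ⟨0, by rintro _ ⟨x, y, -, -, rfl⟩; exact norm_nonneg _⟩ ⟨x, y, hx, hy, rfl⟩

end Projective

section Universe

variable (K : Type*) [NontriviallyNormedField K] [IsUltrametricDist K] (d : ℕ)

/-- The additive group of `1`-Lipschitz functions from the projective space to the unit ball
of `K ^ d` (which is `R ^ d`, where `R` is the ring of integers), with pointwise addition and with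
the topology of uniform convergence. -/
def Universe : AddSubgroup (ℙ K (Fin d → K) →ᵤ (Fin d → K)) where
  carrier := {f | (∀ a, ‖UniformFun.toFun f a‖ ≤ 1) ∧
    ∀ a b, ‖UniformFun.toFun f a - UniformFun.toFun f b‖ ≤ projDist a b}
  zero_mem' := by
    refine ⟨fun a => ?_, fun a b => ?_⟩
    · simp
    · simpa using projDist_nonneg a b
  add_mem' := by
    rintro f g ⟨hf, hf'⟩ ⟨hg, hg'⟩
    refine ⟨fun a => ?_, fun a b => ?_⟩
    · rw [UniformFun.toFun_add, Pi.add_apply]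
      exact (IsUltrametricDist.norm_add_le_max _ _).trans (max_le (hf a) (hg a))
    · rw [UniformFun.toFun_add, Pi.add_apply, Pi.add_apply, add_sub_add_comm]
      exact (IsUltrametricDist.norm_add_le_max _ _).trans (max_le (hf' a b) (hg' a b))
  neg_mem' := by
    rintro f ⟨hf, hf'⟩
    refine ⟨fun a => ?_, fun a b => ?_⟩
    · rw [UniformFun.toFun_neg, Pi.neg_apply, norm_neg]
      exact hf a
    · rw [UniformFun.toFun_neg, Pi.neg_apply, Pi.neg_apply, ← neg_sub', norm_neg]
      exact hf' a b

instance : MeasurableSpace (Universe K d) := borel _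

instance : BorelSpace (Universe K d) := ⟨rfl⟩

variable {K d} in
/-- The projective Kakeya set attached to `f`: the union over all lines `a` of the
unit length segments `{t • can a + f a : t ∈ R}`. -/
def kakeyaSet (f : Universe K d) : Set (Fin d → K) :=
  ⋃ a : ℙ K (Fin d → K), {x | ∃ t ∈ 𝒪[K], x = t • can a + UniformFun.toFun f.1 a}

variable [CompleteSpace K] [IsDiscreteValuationRing 𝒪[K]] [Finite 𝓀[K]]

theorem properSpace : ProperSpace K := by
  have hc : IsClosed ((𝒪[K] : Subring K) : Set K) := by
    have : ((𝒪[K] : Subring K) : Set K) = Metric.closedBall 0 1 := by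
      ext x
      simp [Valued.integer.mem_iff]
    rw [this]
    exact Metric.isClosed_closedBall
  have : CompleteSpace 𝒪[K] := hc.completeSpace_coe
  let _ : (Valued.v : Valuation K NNReal).RankOne :=
    inferInstanceAs (NormedField.valuation (K := K)).RankOne
  have h : CompactSpace 𝒪[K] :=
    Valued.integer.compactSpace_iff_completeSpace_and_isDiscreteValuationRing_and_finite_residueField.mpr
      ⟨inferInstance, inferInstance, inferInstance⟩
  have h' : IsCompact ((𝒪[K] : Subring K) : Set K) := isCompact_iff_compactSpace.mpr h
  have : LocallyCompactSpace K := by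
    refine IsCompact.locallyCompactSpace_of_mem_nhds_of_addGroup (x := 0) h' ?_
    refine Filter.mem_of_superset (Metric.closedBall_mem_nhds 0 zero_lt_one) ?_
    intro x hx
    simpa [Valued.integer.mem_iff] using hx
  exact .of_nontriviallyNormedField_of_weaklyLocallyCompactSpace K

theorem compactSpace_universe : CompactSpace (Universe K d) := by
  have := properSpace K
  let mk : Metric.sphere (0 : Fin d → K) 1 → ℙ K (Fin d → K) := fun x =>
    Projectivization.mk K x.1 (by
      have := x.2
      rw [mem_sphere_zero_iff_norm] at this
      rintro h
      rw [h, norm_zero] at this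
      exact zero_ne_one this)
  have hmk : ∀ x, IsReducedRep (mk x) x.1 := fun x =>
    ⟨mem_sphere_zero_iff_norm.mp x.2, _, rfl⟩
  have hsurj : Function.Surjective mk := by
    intro a
    obtain ⟨⟨h1, h2, h3⟩, -⟩ := can_spec a
    exact ⟨⟨can a, mem_sphere_zero_iff_norm.mpr h1⟩, h3⟩
  let _ : TopologicalSpace (ℙ K (Fin d → K)) := .coinduced mk inferInstance
  have hcont : Continuous mk := continuous_coinduced_rng
  have : CompactSpace (ℙ K (Fin d → K)) := ⟨by
    rw [← Set.range_eq_univ.mpr hsurj]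
    exact isCompact_range hcont⟩
  let F : Universe K d → ℙ K (Fin d → K) → Fin d → K := fun f => UniformFun.toFun f.1
  have heq : Equicontinuous F := by
    intro a
    rw [Metric.equicontinuousAt_iff_right]
    intro ε hε
    let B : Set (ℙ K (Fin d → K)) := {b | ∀ f : Universe K d, dist (F f a) (F f b) < ε}
    have hB : IsOpen B := by
      rw [isOpen_coinduced, Metric.isOpen_iff]
      intro y hy
      refine ⟨ε, hε, fun y' hy' f => ?_⟩
      refine (IsUltrametricDist.dist_triangle_max _ (F f (mk y)) _).trans_lt
        (max_lt (hy f) ?_)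
      rw [dist_eq_norm]
      refine ((f.2.2 (mk y) (mk y')).trans (projDist_le (hmk y) (hmk y'))).trans_lt ?_
      rw [← dist_eq_norm, dist_comm]
      exact hy'
    exact hB.mem_nhds (fun f => by simpa using hε)
  have hind : Topology.IsInducing F :=
    heq.inducing_uniformFun_iff_pi.mp Topology.IsInducing.subtypeVal
  refine ⟨hind.isCompact_iff.mpr ?_⟩
  have hcomp : IsCompact
      (Set.univ.pi fun _ : ℙ K (Fin d → K) => Metric.closedBall (0 : Fin d → K) 1) :=
    isCompact_univ_pi fun _ => isCompact_closedBall _ _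
  have himg : F '' Set.univ = (Set.univ.pi fun _ => Metric.closedBall (0 : Fin d → K) 1) ∩
      ⋂ a, ⋂ b, {f | ‖f a - f b‖ ≤ projDist a b} := by
    ext f
    constructor
    · rintro ⟨g, -, rfl⟩
      exact ⟨fun a _ => mem_closedBall_zero_iff.mpr (g.2.1 a),
        Set.mem_iInter₂.mpr fun a b => g.2.2 a b⟩
    · rintro ⟨h1, h2⟩
      exact ⟨⟨UniformFun.ofFun f, fun a => mem_closedBall_zero_iff.mp (h1 a trivial),
        fun a b => Set.mem_iInter₂.mp h2 a b⟩, trivial, rfl⟩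
  rw [himg]
  refine hcomp.inter_right (isClosed_iInter fun a => isClosed_iInter fun b => ?_)
  exact isClosed_le (((continuous_apply a).sub (continuous_apply b)).norm) continuous_const

/-- The Haar probability measure on the compact group `Universe K d`. -/
noncomputable def universeHaar : Measure (Universe K d) :=
  haveI := compactSpace_universe K d
  Measure.addHaarMeasure ⊤

theorem isAddHaarMeasure_universeHaar : (universeHaar K d).IsAddHaarMeasure :=
  haveI := compactSpace_universe K d
  Measure.isAddHaarMeasure_addHaarMeasure _

theorem isProbabilityMeasure_universeHaar : IsProbabilityMeasure (universeHaar K d) :=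
  haveI := compactSpace_universe K d
  ⟨Measure.addHaarMeasure_self (K₀ := (⊤ : TopologicalSpace.PositiveCompacts (Universe K d)))⟩

/-- The unit ball `R ^ d` of `K ^ d`, as a compact set with non-empty interior. -/
def unitBall : TopologicalSpace.PositiveCompacts (Fin d → K) where
  carrier := Metric.closedBall 0 1
  isCompact' := haveI := properSpace K; isCompact_closedBall 0 1
  interior_nonempty' := ⟨0, mem_interior_iff_mem_nhds.mpr (Metric.closedBall_mem_nhds 0 zero_lt_one)⟩

variable [MeasurableSpace K] [BorelSpace K]

/-- The Haar measure on `K ^ d` giving mass `1` to the unit ball `R ^ d`. -/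
noncomputable def spaceHaar : Measure (Fin d → K) :=
  haveI := properSpace K
  Measure.addHaarMeasure (unitBall K d)

end Universe

end RandomKakeya

/-! By Fubini it is enough that each fixed point x almost surely lies outside N(f), and even at
positive distance from it. If x is within r of the segment in direction a, let j be the pivot of a
and b its affine coordinates. Projecting along a kills the free parameter of the segment, so the
transverse part of f, with components f_i - f_j b_i, is within r at b of that of the constant x.

`transverse j` is a group homomorphism from `Universe K d` onto the 1-Lipschitz self-maps of the
unit ball of K^(d-1), restricted to that ball (`exists_transverse_eq`). By invariance of Haar
measure the transverse part of a random f is therefore uniformly distributed, and the transverse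
part of x can be translated away. What remains is the probability that a uniform 1-Lipschitz
self-map of the ball has a zero modulo π^n.

For a 1-Lipschitz map the first n digits of the output depend only on the first n digits of the
input. The map modulo π^n is thus a tree of depth n with M = q^(d-1) children per node and free
labels in the residue digits. A zero modulo π^n is a branch with all labels zero. Each edge carries
label zero with probability 1/M, so this is a critical branching process, and it dies out because M
≥ 2 (`tendsto_aliveProb`, `measure_exists_near_le`). -/

namespace RandomKakeya

/-! ### Extinction of the critical branching process -/

section Tree

universe u

/-- Trees of depth `n` all of whose inner nodes have children indexed by `I`, every edge being
labelled by an element of `I`. -/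
def DigitTree (I : Type u) : ℕ → Type u
  | 0 => PUnit
  | n + 1 => I → I × DigitTree I n

instance DigitTree.instFinite (I : Type u) [Finite I] : ∀ n, Finite (DigitTree I n)
  | 0 => inferInstanceAs (Finite PUnit)
  | n + 1 =>
    haveI := DigitTree.instFinite I n
    inferInstanceAs (Finite (I → I × DigitTree I n))

instance DigitTree.instNonempty (I : Type u) [Nonempty I] : ∀ n, Nonempty (DigitTree I n)
  | 0 => inferInstanceAs (Nonempty PUnit)
  | n + 1 =>
    haveI := DigitTree.instNonempty I n
    inferInstanceAs (Nonempty (I → I × DigitTree I n))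

/-- A tree is alive if some branch going down to its leaves has all its labels zero. -/
def DigitTree.Alive {I : Type u} [Zero I] : ∀ {n : ℕ}, DigitTree I n → Prop
  | 0, _ => True
  | n + 1, t => ∃ i, ((t : I → I × DigitTree I n) i).1 = 0 ∧ (t i).2.Alive

/-- The probability that a uniformly random tree of depth `n` is alive. -/
noncomputable def aliveProb (M : ℕ) : ℕ → ℝ
  | 0 => 1
  | n + 1 => 1 - (1 - aliveProb M n / M) ^ M

/-- A tree is dead exactly when none of its M independent (label, subtree) pairs has label zero and
a living subtree. Dead trees are therefore counted by an M-th power, which yields the recursion of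
`aliveProb`. -/
theorem DigitTree.card_alive (I : Type u) [Finite I] [Zero I] (n : ℕ) :
    (Nat.card {t : DigitTree I n // t.Alive} : ℝ) =
      aliveProb (Nat.card I) n * Nat.card (DigitTree I n) := by
  induction n with
  | zero =>
    have h1 : Nat.card (DigitTree I 0) = 1 := Nat.card_unique (α := PUnit)
    have h2 : Nat.card {t : DigitTree I 0 // t.Alive} = Nat.card (DigitTree I 0) :=
      Nat.card_congr (Equiv.subtypeUnivEquiv fun _ => trivial)
    rw [h2, h1, aliveProb]; norm_num
  | succ n ih =>
    classical
    set M := Nat.card I with hM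
    set N := Nat.card (DigitTree I n) with hN
    have hM0 : (M : ℝ) ≠ 0 := by
      rw [hM]; exact_mod_cast (Nat.card_pos (α := I)).ne'
    have hN0 : (N : ℝ) ≠ 0 := by
      rw [hN]; exact_mod_cast (Nat.card_pos (α := DigitTree I n)).ne'
    have htot : Nat.card (DigitTree I (n + 1)) = (M * N) ^ M := by
      change Nat.card (I → I × DigitTree I n) = _
      rw [Nat.card_fun, Nat.card_prod]
    let p : I × DigitTree I n → Prop := fun x => x.1 = 0 ∧ x.2.Alive
    have hp : Nat.card {x // p x} = Nat.card {t : DigitTree I n // t.Alive} :=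
      Nat.card_congr
        { toFun := fun x => ⟨x.1.2, x.2.2⟩
          invFun := fun t => ⟨(0, t.1), rfl, t.2⟩
          left_inv := by rintro ⟨⟨i, t⟩, h⟩; exact Subtype.ext (Prod.ext h.1.symm rfl)
          right_inv := fun _ => rfl }
    have hnp : Nat.card {x // p x} + Nat.card {x // ¬ p x} = M * N := by
      rw [← Nat.card_sum, Nat.card_congr (Equiv.sumCompl p), Nat.card_prod]
    have hdead : Nat.card {t : DigitTree I (n + 1) // ¬ t.Alive} = Nat.card {x // ¬ p x} ^ M := by
      rw [← Nat.card_fun]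
      exact Nat.card_congr
        { toFun := fun t i => ⟨t.1 i, fun h => t.2 ⟨i, h⟩⟩
          invFun := fun g => ⟨fun i => (g i).1, fun ⟨i, h⟩ => (g i).2 h⟩
          left_inv := fun _ => rfl
          right_inv := fun _ => rfl }
    have hsum : Nat.card {t : DigitTree I (n + 1) // t.Alive} +
        Nat.card {t : DigitTree I (n + 1) // ¬ t.Alive} = (M * N) ^ M := by
      rw [← Nat.card_sum, Nat.card_congr (Equiv.sumCompl _), htot]
    have h1 : (Nat.card {x // ¬ p x} : ℝ) = M * N - aliveProb M n * N := by
      rw [← ih, ← hp]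
      have := congrArg (Nat.cast : ℕ → ℝ) hnp
      push_cast at this
      linarith
    have h2 := congrArg (Nat.cast : ℕ → ℝ) hsum
    rw [hdead] at h2
    push_cast at h2
    rw [htot]
    push_cast
    rw [eq_sub_of_add_eq h2, h1, aliveProb, sub_mul, one_mul, ← mul_pow]
    congr 2
    field_simp

theorem aliveProb_mem_Icc (M : ℕ) (hM : M ≠ 0) (n : ℕ) : aliveProb M n ∈ Set.Icc (0 : ℝ) 1 := by
  have hM1 : (1 : ℝ) ≤ M := by exact_mod_cast Nat.one_le_iff_ne_zero.mpr hM
  induction n with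
  | zero => simp [aliveProb]
  | succ n ih =>
    have h0 : 0 ≤ aliveProb M n / M := div_nonneg ih.1 (by linarith)
    have h1 : aliveProb M n / M ≤ 1 := (div_le_one (by linarith)).mpr (ih.2.trans hM1)
    rw [aliveProb]
    constructor
    · linarith [pow_le_one₀ (n := M) (sub_nonneg.mpr h1) (by linarith)]
    · linarith [pow_nonneg (sub_nonneg.mpr h1) M]

/-- Bernoulli's inequality, strict because M ≥ 2. With x = p / M it says that p ↦ 1 - (1 - p / M) ^
M moves every p in (0, 1] strictly down. -/
theorem one_sub_mul_lt_one_sub_pow {M : ℕ} (hM : 2 ≤ M) {x : ℝ} (hx : 0 < x) (hx1 : x ≤ 1) :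
    1 - M * x < (1 - x) ^ M := by
  induction M, hM using Nat.le_induction with
  | base => norm_num; nlinarith
  | succ n hn ih =>
    have hn' : (2 : ℝ) ≤ n := by exact_mod_cast hn
    rw [pow_succ]
    push_cast
    rcases hx1.eq_or_lt with rfl | h
    · norm_num; linarith
    · nlinarith [mul_lt_mul_of_pos_right ih (sub_pos.mpr h), mul_pos hx hx]

/-- The sequence is nonincreasing and bounded below, so its limit is a fixed point of the recursion.
Strict Bernoulli leaves 0 as the only fixed point in [0, 1]. -/
theorem tendsto_aliveProb (M : ℕ) (hM : 2 ≤ M) :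
    Filter.Tendsto (aliveProb M) Filter.atTop (nhds 0) := by
  have hI := aliveProb_mem_Icc M (by omega)
  have hM1 : (2 : ℝ) ≤ M := by exact_mod_cast hM
  have hM0 : (M : ℝ) ≠ 0 := by linarith
  have hx1 : ∀ {L : ℝ}, L ≤ 1 → L / M ≤ 1 := fun h =>
    (div_le_one (by linarith)).mpr (by linarith)
  have hanti : Antitone (aliveProb M) := by
    refine antitone_nat_of_succ_le fun n => ?_
    rcases (hI n).1.eq_or_lt with h | h
    · rw [aliveProb, ← h]; simp
    · have := one_sub_mul_lt_one_sub_pow hM (div_pos h (by linarith : (0 : ℝ) < M)) (hx1 (hI n).2)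
      rw [mul_div_cancel₀ _ hM0] at this
      rw [aliveProb]
      linarith
  have hlim := tendsto_atTop_ciInf hanti ⟨0, by rintro _ ⟨n, rfl⟩; exact (hI n).1⟩
  set L := ⨅ n, aliveProb M n
  have hL : L ∈ Set.Icc (0 : ℝ) 1 := isClosed_Icc.mem_of_tendsto hlim (.of_forall hI)
  have hfix : L = 1 - (1 - L / M) ^ M :=
    tendsto_nhds_unique (hlim.comp (Filter.tendsto_add_atTop_nat 1))
      ((((hlim.div_const (M : ℝ)).const_sub 1).pow M).const_sub 1)
  rcases hL.1.eq_or_lt with h | h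
  · rwa [← h] at hlim
  · have := one_sub_mul_lt_one_sub_pow hM (div_pos h (by linarith : (0 : ℝ) < M)) (hx1 hL.2)
    rw [mul_div_cancel₀ _ hM0] at this
    linarith

end Tree

/-! ### Digit expansions and the coding of 1-Lipschitz maps by trees -/

section Lipschitz

theorem norm_sub_le_max {V : Type*} [SeminormedAddCommGroup V] [IsUltrametricDist V] (x y : V) :
    ‖x - y‖ ≤ max ‖x‖ ‖y‖ := by
  simpa [sub_eq_add_neg] using IsUltrametricDist.norm_add_le_max x (-y)

/-- `φ` restricts to a `1`-Lipschitz map from the unit ball to itself. -/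
def IsUnitLipschitz {V : Type*} [NormedAddCommGroup V] (φ : V → V) : Prop :=
  (∀ x, ‖x‖ ≤ 1 → ‖φ x‖ ≤ 1) ∧ ∀ x y, ‖x‖ ≤ 1 → ‖y‖ ≤ 1 → ‖φ x - φ y‖ ≤ ‖x - y‖

variable (K V : Type*) [NontriviallyNormedField K] [NormedAddCommGroup V]
  (I : Type*) [Zero I]

/-- A system of digits in the unit ball for expansions in powers of `π`. -/
structure DigitSystem where
  π : K
  π_ne_zero : π ≠ 0
  norm_π_lt : ‖π‖ < 1
  rep : I → V
  digit : V → I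
  rep_zero : rep 0 = 0
  norm_rep_le : ∀ i, ‖rep i‖ ≤ 1
  norm_sub_rep_digit_le : ∀ x, ‖x‖ ≤ 1 → ‖x - rep (digit x)‖ ≤ ‖π‖
  eq_of_norm_sub_lt : ∀ i j, ‖rep i - rep j‖ < 1 → i = j

variable {K V I}

theorem DigitSystem.norm_π_pos (D : DigitSystem K V I) : 0 < ‖D.π‖ := norm_pos_iff.mpr D.π_ne_zero

theorem DigitSystem.digit_eq [IsUltrametricDist V] (D : DigitSystem K V I) {i : I} {x : V}
    (h : ‖x - D.rep i‖ ≤ ‖D.π‖) : D.digit x = i := by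
  have hx : ‖x‖ ≤ 1 := by
    rw [← sub_add_cancel x (D.rep i)]
    exact (IsUltrametricDist.norm_add_le_max _ _).trans
      (max_le (h.trans D.norm_π_lt.le) (D.norm_rep_le i))
  refine D.eq_of_norm_sub_lt _ _ (lt_of_le_of_lt ?_ D.norm_π_lt)
  rw [← sub_sub_sub_cancel_left _ _ x]
  exact (norm_sub_le_max _ _).trans (max_le h (D.norm_sub_rep_digit_le x hx))

theorem DigitSystem.digit_eq_of_norm_sub_lt [IsUltrametricDist V] (D : DigitSystem K V I)
    {x y : V} (hx : ‖x‖ ≤ 1)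
    (hy : ‖y‖ ≤ 1) (h : ‖x - y‖ < 1) : D.digit x = D.digit y := by
  refine D.eq_of_norm_sub_lt _ _ ?_
  have : D.rep (D.digit x) - D.rep (D.digit y) =
      (x - y) - ((x - D.rep (D.digit x)) - (y - D.rep (D.digit y))) := by abel
  rw [this]
  refine (norm_sub_le_max _ _).trans_lt (max_lt h ?_)
  refine (norm_sub_le_max _ _).trans_lt (max_lt ?_ ?_)
  · exact (D.norm_sub_rep_digit_le x hx).trans_lt D.norm_π_lt
  · exact (D.norm_sub_rep_digit_le y hy).trans_lt D.norm_π_lt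

variable [NormedSpace K V]

theorem DigitSystem.norm_inv_smul_le (D : DigitSystem K V I) {v : V} {r : ℝ}
    (hv : ‖v‖ ≤ ‖D.π‖ * r) : ‖D.π⁻¹ • v‖ ≤ r := by
  rwa [norm_smul, norm_inv, inv_mul_le_iff₀ D.norm_π_pos]

theorem DigitSystem.exists_eq_rep_add (D : DigitSystem K V I) {x : V} (hx : ‖x‖ ≤ 1) :
    ∃ i y, ‖y‖ ≤ 1 ∧ x = D.rep i + D.π • y := by
  refine ⟨D.digit x, D.π⁻¹ • (x - D.rep (D.digit x)), D.norm_inv_smul_le ?_, ?_⟩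
  · rw [mul_one]; exact D.norm_sub_rep_digit_le x hx
  · rw [smul_inv_smul₀ D.π_ne_zero, add_sub_cancel]

variable [IsUltrametricDist V]

/-- The map of the unit ball to itself coded by a tree. -/
noncomputable def DigitSystem.eval (D : DigitSystem K V I) : ∀ {n : ℕ}, DigitTree I n → V → V
  | 0, _, _ => 0
  | n + 1, t, x => D.rep ((t : I → I × DigitTree I n) (D.digit x)).1 +
      D.π • D.eval (t (D.digit x)).2 (D.π⁻¹ • (x - D.rep (D.digit x)))

theorem DigitSystem.norm_rep_add_le (D : DigitSystem K V I) (i : I) {y : V} (hy : ‖y‖ ≤ 1) :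
    ‖D.rep i + D.π • y‖ ≤ 1 := by
  refine (IsUltrametricDist.norm_add_le_max _ _).trans (max_le (D.norm_rep_le i) ?_)
  rw [norm_smul]
  exact mul_le_one₀ D.norm_π_lt.le (norm_nonneg _) hy

theorem DigitSystem.digit_rep_add (D : DigitSystem K V I) (i : I) {y : V} (hy : ‖y‖ ≤ 1) :
    D.digit (D.rep i + D.π • y) = i := by
  refine D.digit_eq ?_
  rw [add_sub_cancel_left, norm_smul]
  exact mul_le_of_le_one_right (norm_nonneg _) hy

theorem DigitSystem.eval_rep_add (D : DigitSystem K V I) {n : ℕ} (t : DigitTree I (n + 1)) (i : I)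
    {y : V} (hy : ‖y‖ ≤ 1) :
    D.eval t (D.rep i + D.π • y) =
      D.rep ((t : I → I × DigitTree I n) i).1 + D.π • D.eval (t i).2 y := by
  rw [eval, D.digit_rep_add i hy, add_sub_cancel_left, inv_smul_smul₀ D.π_ne_zero]

/-- Points at distance at least 1 impose nothing beyond the ultrametric bound on the values. Closer
points share their first digit, and removing it rescales input and output by the same factor π. -/
theorem DigitSystem.isUnitLipschitz_eval (D : DigitSystem K V I) {n : ℕ} (t : DigitTree I n) :
    IsUnitLipschitz (D.eval t) := by
  induction n with
  | zero => constructor <;> intros <;> simp [eval]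
  | succ n ih =>
    have hle : ∀ x, ‖x‖ ≤ 1 → ‖D.eval t x‖ ≤ 1 := by
      intro x hx
      obtain ⟨i, y, hy, rfl⟩ := D.exists_eq_rep_add hx
      rw [D.eval_rep_add t i hy]
      exact D.norm_rep_add_le _ ((ih _).1 y hy)
    refine ⟨hle, fun x x' hx hx' => ?_⟩
    by_cases h : ‖x - x'‖ < 1
    · have hd := D.digit_eq_of_norm_sub_lt hx hx' h
      obtain ⟨i, y, hy, rfl⟩ := D.exists_eq_rep_add hx
      obtain ⟨i', y', hy', rfl⟩ := D.exists_eq_rep_add hx'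
      rw [D.digit_rep_add i hy, D.digit_rep_add i' hy'] at hd
      subst hd
      rw [D.eval_rep_add t i hy, D.eval_rep_add t i hy', add_sub_add_left_eq_sub,
        add_sub_add_left_eq_sub, ← smul_sub, ← smul_sub, norm_smul, norm_smul]
      exact mul_le_mul_of_nonneg_left ((ih _).2 y y' hy hy') (norm_nonneg _)
    · exact (norm_sub_le_max _ _).trans
        ((max_le (hle x hx) (hle x' hx')).trans (not_lt.mp h))

/-- On each ball `rep i + π • V₁`, with V₁ the unit ball, the first digit of φ is constant.
Stripping that digit and dividing by π leaves another 1-Lipschitz self-map of the ball, to which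
induction applies. -/
theorem DigitSystem.exists_eval_near (D : DigitSystem K V I) (n : ℕ) {φ : V → V}
    (hφ : IsUnitLipschitz φ) :
    ∃ t : DigitTree I n, ∀ x, ‖x‖ ≤ 1 → ‖φ x - D.eval t x‖ ≤ ‖D.π‖ ^ n := by
  induction n generalizing φ with
  | zero => exact ⟨PUnit.unit, fun x hx => by simpa [eval] using hφ.1 x hx⟩
  | succ n ih =>
    let ψ : I → V → V := fun i y =>
      D.π⁻¹ • (φ (D.rep i + D.π • y) - D.rep (D.digit (φ (D.rep i))))
    have hψ : ∀ i, IsUnitLipschitz (ψ i) := by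
      intro i
      constructor
      · intro y hy
        refine D.norm_inv_smul_le ?_
        rw [mul_one, ← sub_add_sub_cancel _ (φ (D.rep i))]
        refine (IsUltrametricDist.norm_add_le_max _ _).trans (max_le ?_
          (D.norm_sub_rep_digit_le _ (hφ.1 _ (D.norm_rep_le i))))
        refine (hφ.2 _ _ (D.norm_rep_add_le i hy) (D.norm_rep_le i)).trans ?_
        rw [add_sub_cancel_left, norm_smul]
        exact mul_le_of_le_one_right (norm_nonneg _) hy
      · intro y y' hy hy'
        rw [← smul_sub]
        refine D.norm_inv_smul_le ?_
        rw [sub_sub_sub_cancel_right]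
        refine (hφ.2 _ _ (D.norm_rep_add_le i hy) (D.norm_rep_add_le i hy')).trans ?_
        rw [add_sub_add_left_eq_sub, ← smul_sub, norm_smul]
    choose T hT using fun i => ih (hψ i)
    let t : DigitTree I (n + 1) := fun i => (D.digit (φ (D.rep i)), T i)
    refine ⟨t, fun x hx => ?_⟩
    obtain ⟨i, y, hy, rfl⟩ := D.exists_eq_rep_add hx
    rw [D.eval_rep_add t i hy]
    have h1 : φ (D.rep i + D.π • y) = D.rep (D.digit (φ (D.rep i))) + D.π • ψ i y := by
      simp only [ψ]
      rw [smul_inv_smul₀ D.π_ne_zero, add_sub_cancel]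
    rw [h1, pow_succ']
    change ‖_ - (D.rep (D.digit (φ (D.rep i))) + D.π • D.eval (T i) y)‖ ≤ _
    rw [add_sub_add_left_eq_sub, ← smul_sub, norm_smul]
    exact mul_le_mul_of_nonneg_left (hT i y hy) (norm_nonneg _)

theorem DigitSystem.digits_of_norm_rep_add_sub_le (D : DigitSystem K V I) {n : ℕ} {i j : I}
    {v w : V} (hv : ‖v‖ ≤ 1) (hw : ‖w‖ ≤ 1)
    (h : ‖(D.rep i + D.π • v) - (D.rep j + D.π • w)‖ ≤ ‖D.π‖ ^ (n + 1)) :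
    i = j ∧ ‖v - w‖ ≤ ‖D.π‖ ^ n := by
  have hij : i = j := by
    rw [← D.digit_rep_add i hv, ← D.digit_rep_add j hw]
    refine D.digit_eq_of_norm_sub_lt (D.norm_rep_add_le i hv) (D.norm_rep_add_le j hw)
      (h.trans_lt (pow_lt_one₀ (norm_nonneg _) D.norm_π_lt n.succ_ne_zero))
  subst hij
  refine ⟨rfl, ?_⟩
  rw [add_sub_add_left_eq_sub, ← smul_sub, norm_smul, pow_succ'] at h
  exact le_of_mul_le_mul_left h D.norm_π_pos

/-- Precision `‖π‖ ^ n` suffices to read off every label, level by level. Hence each 1-Lipschitz map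
is coded by only one tree of depth n. -/
theorem DigitSystem.eval_injective (D : DigitSystem K V I) {n : ℕ} {t t' : DigitTree I n}
    (h : ∀ x, ‖x‖ ≤ 1 → ‖D.eval t x - D.eval t' x‖ ≤ ‖D.π‖ ^ n) : t = t' := by
  induction n with
  | zero => rfl
  | succ n ih =>
    funext i
    have key : ∀ y, ‖y‖ ≤ 1 → _ := fun y hy => by
      have := h _ (D.norm_rep_add_le i hy)
      rw [D.eval_rep_add t i hy, D.eval_rep_add t' i hy] at this
      exact D.digits_of_norm_rep_add_sub_le ((D.isUnitLipschitz_eval _).1 y hy)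
        ((D.isUnitLipschitz_eval _).1 y hy) this
    exact Prod.ext (key 0 (by simp)).1 (ih fun y hy => (key y hy).2)

/-- The digits of x select a branch, and the labels along it are the digits of the value at x. A
value that vanishes to order n forces all these labels to be zero. -/
theorem DigitSystem.alive_of_norm_eval_le (D : DigitSystem K V I) {n : ℕ} {t : DigitTree I n}
    {x : V} (hx : ‖x‖ ≤ 1) (h : ‖D.eval t x‖ ≤ ‖D.π‖ ^ n) : t.Alive := by
  induction n generalizing x with
  | zero => trivial
  | succ n ih =>
    obtain ⟨i, y, hy, rfl⟩ := D.exists_eq_rep_add hx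
    rw [D.eval_rep_add t i hy] at h
    -- Zero is written as a digit expansion so that first digits can be compared.
    have h0 : D.rep (0 : I) + D.π • (0 : V) = 0 := by rw [D.rep_zero, smul_zero, add_zero]
    rw [← sub_zero (_ + _), ← h0] at h
    obtain ⟨h1, h2⟩ := D.digits_of_norm_rep_add_sub_le ((D.isUnitLipschitz_eval _).1 y hy)
      (by simp) h
    rw [sub_zero] at h2
    exact ⟨i, h1, ih hy h2⟩

end Lipschitz

/-! ### Uniform distribution of the coding tree -/

section Probability

variable {K V I Ω : Type*} [NontriviallyNormedField K] [NormedAddCommGroup V] [NormedSpace K V]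
  [IsUltrametricDist V] [Zero I] [Finite I] [AddCommGroup Ω] [MeasurableSpace Ω] [MeasurableAdd Ω]

/-- If `Φ` maps the random element `ω` to a uniformly random `1`-Lipschitz map of the unit ball,
the probability that `Φ ω` comes close to a given `1`-Lipschitz map is controlled by the
survival probability of a critical branching process. -/
theorem measure_exists_near_le (D : DigitSystem K V I) (μ : Measure Ω) [IsProbabilityMeasure μ]
    [μ.IsAddLeftInvariant] (Φ : Ω →+ V → V) (hΦ : ∀ ω, IsUnitLipschitz (Φ ω))
    (hsurj : ∀ φ, IsUnitLipschitz φ → ∃ ω, ∀ x, ‖x‖ ≤ 1 → Φ ω x = φ x)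
    (hmeas : ∀ r, MeasurableSet {ω | ∀ x, ‖x‖ ≤ 1 → ‖Φ ω x‖ ≤ r})
    {ψ : V → V} (hψ : IsUnitLipschitz ψ) (n : ℕ) :
    μ {ω | ∃ x, ‖x‖ ≤ 1 ∧ ‖Φ ω x - ψ x‖ ≤ ‖D.π‖ ^ n} ≤
      ENNReal.ofReal (aliveProb (Nat.card I) n) := by
  classical
  have : Fintype (DigitTree I n) := Fintype.ofFinite _
  obtain ⟨ω₀, hω₀⟩ := hsurj ψ hψ
  choose w hw using fun t : DigitTree I n => hsurj _ (D.isUnitLipschitz_eval t)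
  let L : Set Ω := {ω | ∀ x, ‖x‖ ≤ 1 → ‖Φ ω x‖ ≤ ‖D.π‖ ^ n}
  -- `C t` is the event that t codes `Φ ω` to order n. These events partition Ω and are translates
  -- of the single set L, so each has probability one over the number of trees.
  let C : DigitTree I n → Set Ω := fun t => (fun ω => (-w t) + ω) ⁻¹' L
  have hC : ∀ t ω, ω ∈ C t ↔ ∀ x, ‖x‖ ≤ 1 → ‖Φ ω x - D.eval t x‖ ≤ ‖D.π‖ ^ n := by
    intro t ω
    refine forall₂_congr fun x hx => ?_
    rw [map_add, map_neg, Pi.add_apply, Pi.neg_apply, hw t x hx, neg_add_eq_sub]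
  have hCmeas : ∀ t, MeasurableSet (C t) := fun t => (measurable_const_add _) (hmeas _)
  have hCμ : ∀ t, μ (C t) = μ L := fun t => measure_preimage_add _ _ _
  have hdisj : Pairwise (Function.onFun Disjoint C) := by
    intro t t' htt'
    refine Set.disjoint_left.mpr fun ω h h' => htt' (D.eval_injective fun x hx => ?_)
    rw [← sub_sub_sub_cancel_left _ _ (Φ ω x)]
    exact (norm_sub_le_max _ _).trans (max_le ((hC t' ω).mp h' x hx) ((hC t ω).mp h x hx))
  have hcard : (Nat.card (DigitTree I n) : ENNReal) * μ L = 1 := by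
    have h1 : ⋃ t, C t = Set.univ := Set.eq_univ_of_forall fun ω => by
      obtain ⟨t, ht⟩ := D.exists_eval_near n (hΦ ω)
      exact Set.mem_iUnion.mpr ⟨t, (hC t ω).mpr ht⟩
    have h2 := measure_iUnion (μ := μ) hdisj hCmeas
    rw [h1, measure_univ, tsum_fintype, Finset.sum_congr rfl fun t _ => hCμ t, Finset.sum_const,
      Finset.card_univ, nsmul_eq_mul] at h2
    rw [Nat.card_eq_fintype_card, ← h2]
  -- Translation by a preimage of ψ replaces closeness to ψ by closeness to 0, which forces the
  -- coding tree to be alive.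
  have hsub : (fun ω => ω₀ + ω) ⁻¹' {ω | ∃ x, ‖x‖ ≤ 1 ∧ ‖Φ ω x - ψ x‖ ≤ ‖D.π‖ ^ n} ⊆
      ⋃ t : {t : DigitTree I n // t.Alive}, C t := by
    rintro ω ⟨x, hx, h⟩
    rw [map_add, Pi.add_apply, hω₀ x hx, add_sub_cancel_left] at h
    obtain ⟨t, ht⟩ := D.exists_eval_near n (hΦ ω)
    refine Set.mem_iUnion.mpr ⟨⟨t, D.alive_of_norm_eval_le hx ?_⟩, (hC t ω).mpr ht⟩
    rw [← sub_sub_cancel (Φ ω x) (D.eval t x)]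
    exact (norm_sub_le_max _ _).trans (max_le h (ht x hx))
  rw [← measure_preimage_add μ ω₀]
  calc _ ≤ μ (⋃ t : {t : DigitTree I n // t.Alive}, C t) := measure_mono hsub
    _ ≤ ∑ t : {t : DigitTree I n // t.Alive}, μ (C t) := measure_iUnion_fintype_le _ _
    _ = (Nat.card {t : DigitTree I n // t.Alive} : ENNReal) * μ L := by
      rw [Finset.sum_congr rfl fun t _ => hCμ t.1, Finset.sum_const, Finset.card_univ,
        nsmul_eq_mul, Nat.card_eq_fintype_card]
    _ = ENNReal.ofReal (aliveProb (Nat.card I) n) := by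
      rw [← ENNReal.ofReal_natCast, DigitTree.card_alive,
        ENNReal.ofReal_mul (aliveProb_mem_Icc _ (Nat.card_pos).ne' n).1, ENNReal.ofReal_natCast,
        mul_assoc, hcard, mul_one]

end Probability

/-! ### Residue digits -/

section Digits

variable (K : Type*) [NontriviallyNormedField K] [IsUltrametricDist K]
  [IsDiscreteValuationRing 𝒪[K]]

/-- Discreteness enters here: the gap below norm 1 turns congruence in the residue field into a
remainder divisible by π. -/
theorem exists_uniformizer : ∃ ϖ : K, ϖ ≠ 0 ∧ ‖ϖ‖ < 1 ∧ ∀ x : K, ‖x‖ < 1 → ‖x‖ ≤ ‖ϖ‖ := by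
  obtain ⟨ϖ, hϖ⟩ := IsDiscreteValuationRing.exists_irreducible 𝒪[K]
  refine ⟨ϖ, fun h => hϖ.ne_zero (Subtype.ext h), Valued.integer.norm_irreducible_lt_one hϖ,
    fun x hx => ?_⟩
  let y : 𝒪[K] := ⟨x, Valued.integer.mem_iff.mpr hx.le⟩
  have hy : y ∈ 𝓂[K] := by
    rw [IsLocalRing.mem_maximalIdeal, mem_nonunits_iff, Valued.integer.isUnit_iff_norm_eq_one]
    exact hx.ne
  have : y ∈ (𝓂[K] : Set 𝒪[K]) := hy
  rw [hϖ.maximalIdeal_eq_closedBall, mem_closedBall_zero_iff] at this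
  exact this

/-- The residue digits of vectors with coordinates in `K`. -/
theorem nonempty_digitSystem (ι : Type*) [Fintype ι] :
    Nonempty (DigitSystem K (ι → K) (ι → 𝓀[K])) := by
  classical
  obtain ⟨ϖ, h0, h1, hϖ⟩ := exists_uniformizer K
  -- A section of the residue map, corrected at 0 so that the zero digit is represented by 0.
  let s : 𝓀[K] → 𝒪[K] :=
    Function.update (Function.surjInv (IsLocalRing.residue_surjective (R := 𝒪[K]))) 0 0
  have hs : ∀ c, IsLocalRing.residue 𝒪[K] (s c) = c := by
    intro c
    by_cases hc : c = 0
    · subst hc; simp [s]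
    · simp [s, hc, Function.surjInv_eq]
  have hres : ∀ x y : 𝒪[K], IsLocalRing.residue 𝒪[K] x = IsLocalRing.residue 𝒪[K] y ↔
      ‖(x : K) - y‖ < 1 := by
    intro x y
    rw [← sub_eq_zero, ← map_sub, IsLocalRing.residue_eq_zero_iff, IsLocalRing.mem_maximalIdeal,
      mem_nonunits_iff, Valued.integer.isUnit_iff_norm_eq_one]
    exact ⟨fun h => (Valued.integer.norm_le_one (x - y)).lt_of_ne h, fun h => h.ne⟩
  refine ⟨{
    π := ϖ
    π_ne_zero := h0
    norm_π_lt := h1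
    rep := fun c i => s (c i)
    digit := fun x i => if h : x i ∈ 𝒪[K] then IsLocalRing.residue 𝒪[K] ⟨x i, h⟩ else 0
    rep_zero := by funext i; simp [s]
    norm_rep_le := fun c => (pi_norm_le_iff_of_nonneg zero_le_one).mpr fun i =>
      Valued.integer.norm_le_one _
    norm_sub_rep_digit_le := ?_
    eq_of_norm_sub_lt := ?_ }⟩
  · intro x hx
    refine (pi_norm_le_iff_of_nonneg (norm_nonneg _)).mpr fun i => hϖ _ ?_
    have hi : x i ∈ 𝒪[K] := Valued.integer.mem_iff.mpr ((norm_le_pi_norm x i).trans hx)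
    simp only [Pi.sub_apply, dif_pos hi]
    exact (hres ⟨x i, hi⟩ _).mp (hs _).symm
  · intro c c' h
    funext i
    rw [← hs (c i), ← hs (c' i), hres]
    exact (norm_le_pi_norm (fun i => (s (c i) : K) - s (c' i)) i).trans_lt h

end Digits

/-! ### Affine charts and the transverse component -/

section Charts

variable {K : Type*} [NontriviallyNormedField K] {d : ℕ}

/-- The vector with `j`-th coordinate `1` and the other coordinates given by `b`. -/
noncomputable def affineLift (j : Fin d) (b : {i // i ≠ j} → K) : Fin d → K :=
  fun i => if h : i = j then 1 else b ⟨i, h⟩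

@[simp]
theorem affineLift_self (j : Fin d) (b : {i // i ≠ j} → K) : affineLift j b j = 1 := by
  simp [affineLift]

@[simp]
theorem affineLift_coe (j : Fin d) (b : {i // i ≠ j} → K) (i : {i // i ≠ j}) :
    affineLift j b i = b i := by
  simp [affineLift, i.2]

theorem affineLift_ne_zero (j : Fin d) (b : {i // i ≠ j} → K) : affineLift j b ≠ 0 :=
  fun h => one_ne_zero ((affineLift_self j b).symm.trans (congrFun h j))

theorem affineLift_restrict (j : Fin d) {x : Fin d → K} (hx : x j = 1) :
    affineLift j (fun i => x i) = x := by
  funext i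
  by_cases h : i = j
  · subst h; simp [hx]
  · exact affineLift_coe j (fun i => x i) ⟨i, h⟩

theorem norm_affineLift (j : Fin d) {b : {i // i ≠ j} → K} (hb : ‖b‖ ≤ 1) :
    ‖affineLift j b‖ = 1 := by
  refine le_antisymm ((pi_norm_le_iff_of_nonneg zero_le_one).mpr fun i => ?_) ?_
  · by_cases h : i = j
    · subst h; simp
    · have := affineLift_coe j b ⟨i, h⟩
      simp only at this
      rw [this]
      exact (norm_le_pi_norm b _).trans hb
  · simpa using norm_le_pi_norm (affineLift j b) j

theorem norm_affineLift_sub (j : Fin d) (b b' : {i // i ≠ j} → K) :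
    ‖affineLift j b - affineLift j b'‖ ≤ ‖b - b'‖ := by
  refine (pi_norm_le_iff_of_nonneg (norm_nonneg _)).mpr fun i => ?_
  by_cases h : i = j
  · subst h; simp
  · have h1 := affineLift_coe j b ⟨i, h⟩
    have h2 := affineLift_coe j b' ⟨i, h⟩
    simp only at h1 h2
    rw [Pi.sub_apply, h1, h2]
    exact norm_le_pi_norm (b - b') ⟨i, h⟩

/-- The affine chart of the projective space where the `j`-th coordinate does not vanish. -/
noncomputable def affineChart (j : Fin d) (b : {i // i ≠ j} → K) : ℙ K (Fin d → K) :=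
  Projectivization.mk K (affineLift j b) (affineLift_ne_zero j b)

theorem isReducedRep_affineLift (j : Fin d) {b : {i // i ≠ j} → K} (hb : ‖b‖ ≤ 1) :
    IsReducedRep (affineChart j b) (affineLift j b) :=
  ⟨norm_affineLift j hb, affineLift_ne_zero j b, rfl⟩

theorem projDist_affineChart_le (j : Fin d) {b b' : {i // i ≠ j} → K} (hb : ‖b‖ ≤ 1)
    (hb' : ‖b'‖ ≤ 1) : projDist (affineChart j b) (affineChart j b') ≤ ‖b - b'‖ :=
  (projDist_le (isReducedRep_affineLift j hb) (isReducedRep_affineLift j hb')).trans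
    (norm_affineLift_sub j b b')

theorem le_projDist {a a' : ℙ K (Fin d → K)} {r : ℝ}
    (h : ∀ x y, IsReducedRep a x → IsReducedRep a' y → r ≤ ‖x - y‖) : r ≤ projDist a a' :=
  le_csInf ⟨_, _, _, (can_spec a).1, (can_spec a').1, rfl⟩ fun _ ⟨x, y, hx, hy, hr⟩ =>
    hr ▸ h x y hx hy

theorem projDist_comm (a b : ℙ K (Fin d → K)) : projDist a b = projDist b a := by
  refine congrArg sInf (Set.ext fun r => ⟨?_, ?_⟩) <;>
  · rintro ⟨x, y, hx, hy, rfl⟩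
    exact ⟨y, x, hy, hx, norm_sub_rev _ _⟩

/-- Reduced representatives of a point in a chart. -/
theorem IsReducedRep.eq_smul_affineLift {j : Fin d} {b : {i // i ≠ j} → K} (hb : ‖b‖ ≤ 1)
    {x : Fin d → K} (hx : IsReducedRep (affineChart j b) x) :
    ‖x j‖ = 1 ∧ ∀ i : {i // i ≠ j}, x i = x j * b i := by
  obtain ⟨hx1, hx0, hxa⟩ := hx
  obtain ⟨c, hc⟩ := (Projectivization.mk_eq_mk_iff' K _ _ hx0 (affineLift_ne_zero j b)).mp hxa
  have hcj : x j = c := by rw [← hc]; simp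
  constructor
  · rw [hcj, ← hx1, ← hc, norm_smul, norm_affineLift j hb, mul_one]
  · intro i
    rw [hcj, ← hc]
    simp

theorem IsReducedRep.exists_eq_affineChart {a : ℙ K (Fin d → K)} {x : Fin d → K}
    (hx : IsReducedRep a x) {j : Fin d} (hj : ‖x j‖ = 1) :
    ∃ b : {i // i ≠ j} → K, ‖b‖ ≤ 1 ∧ a = affineChart j b := by
  obtain ⟨hx1, hx0, rfl⟩ := hx
  have hj0 : x j ≠ 0 := norm_pos_iff.mp (hj ▸ one_pos)
  refine ⟨fun i => (x j)⁻¹ * x i, (pi_norm_le_iff_of_nonneg zero_le_one).mpr fun i => ?_, ?_⟩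
  · rw [norm_mul, norm_inv, hj, inv_one, one_mul]
    exact (norm_le_pi_norm x i).trans hx1.le
  · refine (Projectivization.mk_eq_mk_iff' K _ _ _ _).mpr ⟨x j, ?_⟩
    have := affineLift_restrict (x := (x j)⁻¹ • x) j (by simp [hj0])
    change x j • affineLift j (fun i => ((x j)⁻¹ • x) i) = x
    rw [this, smul_inv_smul₀ hj0]

variable [IsUltrametricDist K]

/-- The affine coordinates are recovered from any reduced representatives by dividing by a
coordinate of norm 1. Together with `projDist_affineChart_le`, this makes the chart an isometry on
the unit ball. -/
theorem norm_sub_le_projDist_affineChart (j : Fin d) {b b' : {i // i ≠ j} → K} (hb : ‖b‖ ≤ 1)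
    (hb' : ‖b'‖ ≤ 1) : ‖b - b'‖ ≤ projDist (affineChart j b) (affineChart j b') := by
  refine le_projDist fun x y hx hy => (pi_norm_le_iff_of_nonneg (norm_nonneg _)).mpr fun i => ?_
  obtain ⟨hxj, hxi⟩ := hx.eq_smul_affineLift hb
  obtain ⟨hyj, hyi⟩ := hy.eq_smul_affineLift hb'
  have h1 : x j * (b i - b' i) = (x - y) i - (x - y) j * b' i := by
    rw [Pi.sub_apply, Pi.sub_apply, hxi, hyi]; ring
  calc ‖(b - b') i‖ = ‖x j * (b i - b' i)‖ := by rw [norm_mul, hxj, one_mul, Pi.sub_apply]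
    _ ≤ max ‖(x - y) i‖ ‖(x - y) j * b' i‖ := h1 ▸ norm_sub_le_max _ _
    _ ≤ ‖x - y‖ := by
      refine max_le (norm_le_pi_norm _ _) ?_
      rw [norm_mul]
      exact (mul_le_of_le_one_right (norm_nonneg _) ((norm_le_pi_norm b' i).trans hb')).trans
        (norm_le_pi_norm _ _)

theorem one_le_projDist_affineChart (j : Fin d) {b : {i // i ≠ j} → K} (hb : ‖b‖ ≤ 1)
    {a : ℙ K (Fin d → K)} (ha : ¬ ∃ b' : {i // i ≠ j} → K, ‖b'‖ ≤ 1 ∧ a = affineChart j b') :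
    1 ≤ projDist (affineChart j b) a := by
  refine le_projDist fun x y hx hy => ?_
  have hxj := (hx.eq_smul_affineLift hb).1
  have hyj : ‖y j‖ < 1 := ((norm_le_pi_norm y j).trans hy.1.le).lt_of_ne fun h =>
    ha (hy.exists_eq_affineChart h)
  by_contra! h
  have : ‖x j‖ < 1 := by
    rw [← sub_add_cancel (x j) (y j)]
    exact (IsUltrametricDist.norm_add_le_max _ _).trans_lt
      (max_lt ((norm_le_pi_norm (x - y) j).trans_lt h) hyj)
  exact this.ne hxj

/-- Extension by zero works: the chart is isometric on the unit ball, and lines outside its image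
are at distance at least 1, where any two values in the unit ball are allowed. -/
theorem Universe.exists_affineChart_eq (j : Fin d) {φ : ({i // i ≠ j} → K) → Fin d → K}
    (hφ : ∀ b, ‖b‖ ≤ 1 → ‖φ b‖ ≤ 1)
    (hφ' : ∀ b b', ‖b‖ ≤ 1 → ‖b'‖ ≤ 1 → ‖φ b - φ b'‖ ≤ ‖b - b'‖) :
    ∃ f : Universe K d, ∀ b, ‖b‖ ≤ 1 → UniformFun.toFun f.1 (affineChart j b) = φ b := by
  classical
  let F : ℙ K (Fin d → K) → Fin d → K := fun a =>
    if h : ∃ b : {i // i ≠ j} → K, ‖b‖ ≤ 1 ∧ a = affineChart j b then φ h.choose else 0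
  have hF : ∀ b, ‖b‖ ≤ 1 → F (affineChart j b) = φ b := by
    intro b hb
    have h : ∃ b' : {i // i ≠ j} → K, ‖b'‖ ≤ 1 ∧ affineChart j b = affineChart j b' := ⟨b, hb, rfl⟩
    have hb' := h.choose_spec
    simp only [F, dif_pos h]
    congr 1
    rw [← sub_eq_zero, ← norm_le_zero_iff]
    refine (norm_sub_le_projDist_affineChart j hb'.1 hb).trans ?_
    rw [← hb'.2]
    simpa using projDist_affineChart_le j hb hb
  have hF0 : ∀ a, (¬ ∃ b : {i // i ≠ j} → K, ‖b‖ ≤ 1 ∧ a = affineChart j b) → F a = 0 :=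
    fun a ha => dif_neg ha
  refine ⟨⟨UniformFun.ofFun F, fun a => ?_, fun a a' => ?_⟩, hF⟩
  · change ‖F a‖ ≤ 1
    by_cases ha : ∃ b : {i // i ≠ j} → K, ‖b‖ ≤ 1 ∧ a = affineChart j b
    · obtain ⟨b, hb, rfl⟩ := ha
      exact hF b hb ▸ hφ b hb
    · simp [hF0 a ha]
  · change ‖F a - F a'‖ ≤ _
    by_cases ha : ∃ b : {i // i ≠ j} → K, ‖b‖ ≤ 1 ∧ a = affineChart j b
    · obtain ⟨b, hb, rfl⟩ := ha
      by_cases ha' : ∃ b : {i // i ≠ j} → K, ‖b‖ ≤ 1 ∧ a' = affineChart j b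
      · obtain ⟨b', hb', rfl⟩ := ha'
        rw [hF b hb, hF b' hb']
        exact (hφ' b b' hb hb').trans (norm_sub_le_projDist_affineChart j hb hb')
      · rw [hF b hb, hF0 a' ha', sub_zero]
        exact (hφ b hb).trans (one_le_projDist_affineChart j hb ha')
    · rw [hF0 a ha, zero_sub, norm_neg]
      by_cases ha' : ∃ b : {i // i ≠ j} → K, ‖b‖ ≤ 1 ∧ a' = affineChart j b
      · obtain ⟨b', hb', rfl⟩ := ha'
        rw [hF b' hb', projDist_comm]
        exact (hφ b' hb').trans (one_le_projDist_affineChart j hb' ha)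
      · rw [hF0 a' ha', norm_zero]
        exact projDist_nonneg _ _

/-- The component of `f` transverse to the lines, read in an affine chart: its value at `b` is the
projection of `f` at the line spanned by `affineLift j b` along that line. -/
noncomputable def transverse (j : Fin d) :
    Universe K d →+ ({i // i ≠ j} → K) → ({i // i ≠ j} → K) where
  toFun f b i := UniformFun.toFun f.1 (affineChart j b) i -
    UniformFun.toFun f.1 (affineChart j b) j * b i
  map_zero' := by funext b i; simp
  map_add' f g := by
    funext b i
    simp only [AddSubgroup.coe_add, UniformFun.toFun_add, Pi.add_apply]
    ring

theorem transverse_apply (j : Fin d) (f : Universe K d) (b : {i // i ≠ j} → K)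
    (i : {i // i ≠ j}) : transverse j f b i = UniformFun.toFun f.1 (affineChart j b) i -
      UniformFun.toFun f.1 (affineChart j b) j * b i := rfl

/-- The product `f_j b` is handled as in the Leibniz rule. All factors have norm at most 1, and the
ultrametric inequality keeps the constant equal to 1. -/
theorem isUnitLipschitz_transverse (j : Fin d) (f : Universe K d) :
    IsUnitLipschitz (transverse j f) := by
  have hf : ∀ b i, ‖UniformFun.toFun f.1 (affineChart j b) i‖ ≤ 1 := fun b i =>
    (norm_le_pi_norm _ i).trans (f.2.1 _)
  constructor
  · intro b hb
    refine (pi_norm_le_iff_of_nonneg zero_le_one).mpr fun i => ?_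
    refine (norm_sub_le_max _ _).trans (max_le (hf b i) ?_)
    rw [norm_mul]
    exact mul_le_one₀ (hf b j) (norm_nonneg _) ((norm_le_pi_norm b i).trans hb)
  · intro b b' hb hb'
    have hfd : ∀ i, ‖UniformFun.toFun f.1 (affineChart j b) i -
        UniformFun.toFun f.1 (affineChart j b') i‖ ≤ ‖b - b'‖ := fun i =>
      (norm_le_pi_norm (UniformFun.toFun f.1 (affineChart j b) -
        UniformFun.toFun f.1 (affineChart j b')) i).trans
        ((f.2.2 _ _).trans (projDist_affineChart_le j hb hb'))
    refine (pi_norm_le_iff_of_nonneg (norm_nonneg _)).mpr fun i => ?_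
    have h : (transverse j f b - transverse j f b') i =
        (UniformFun.toFun f.1 (affineChart j b) i - UniformFun.toFun f.1 (affineChart j b') i) -
        (UniformFun.toFun f.1 (affineChart j b) j * (b - b') i +
        (UniformFun.toFun f.1 (affineChart j b) j - UniformFun.toFun f.1 (affineChart j b') j) *
          b' i) := by
      rw [Pi.sub_apply, Pi.sub_apply, transverse_apply, transverse_apply]; ring
    rw [h]
    refine (norm_sub_le_max _ _).trans (max_le (hfd i)
      ((IsUltrametricDist.norm_add_le_max _ _).trans (max_le ?_ ?_)))
    · rw [norm_mul]
      exact (mul_le_of_le_one_left (norm_nonneg _) (hf b j)).trans (norm_le_pi_norm _ i)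
    · rw [norm_mul]
      exact (mul_le_of_le_one_right (norm_nonneg _) ((norm_le_pi_norm b' i).trans hb')).trans
        (hfd j)

theorem exists_transverse_eq (j : Fin d) {φ : ({i // i ≠ j} → K) → ({i // i ≠ j} → K)}
    (hφ : IsUnitLipschitz φ) :
    ∃ f : Universe K d, ∀ b, ‖b‖ ≤ 1 → transverse j f b = φ b := by
  -- `E v` has coordinates v away from j and 0 at j. With vanishing j-th component, the transverse
  -- part of f is f itself.
  let E : ({i // i ≠ j} → K) → Fin d → K := fun v => affineLift j v - affineLift j 0
  have hEsub : ∀ v w, E v - E w = affineLift j v - affineLift j w := fun v w =>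
    sub_sub_sub_cancel_right _ _ _
  have hE : ∀ v, ‖E v‖ ≤ ‖v‖ := fun v => by simpa using norm_affineLift_sub j v 0
  obtain ⟨f, hf⟩ := Universe.exists_affineChart_eq j (φ := fun b => E (φ b))
    (fun b hb => (hE _).trans (hφ.1 b hb))
    (fun b b' hb hb' => by
      rw [hEsub]; exact (norm_affineLift_sub j _ _).trans (hφ.2 b b' hb hb'))
  refine ⟨f, fun b hb => ?_⟩
  funext i
  rw [transverse_apply, hf b hb]
  simp [E]

/-- The constant function with value `x`. -/
noncomputable def Universe.const (x : Fin d → K) (hx : ‖x‖ ≤ 1) : Universe K d :=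
  ⟨UniformFun.ofFun fun _ => x, fun _ => hx, fun a b => by
    simpa using projDist_nonneg a b⟩

/-- If `x` is close to the segment of direction `a` attached to `f`, then `f` is close to the
constant function `x` transversally to `a`. -/
theorem exists_norm_transverse_sub_le {f : Universe K d} {x : Fin d → K} (hx : ‖x‖ ≤ 1)
    {a : ℙ K (Fin d → K)} {t : K} {r : ℝ}
    (h : ‖x - (t • can a + UniformFun.toFun f.1 a)‖ ≤ r) :
    ∃ j : Fin d, ∃ b : {i // i ≠ j} → K, ‖b‖ ≤ 1 ∧
      ‖transverse j f b - transverse j (Universe.const x hx) b‖ ≤ r := by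
  obtain ⟨⟨h1, h0, ha⟩, j, hj, -⟩ := can_spec a
  have hlift := affineLift_restrict j hj
  set b : {i // i ≠ j} → K := fun i => can a i with hbdef
  have hb : ‖b‖ ≤ 1 := (pi_norm_le_iff_of_nonneg zero_le_one).mpr fun i =>
    (norm_le_pi_norm (can a) i).trans h1.le
  have hchart : affineChart j b = a := by
    rw [← ha, affineChart]; congr 1
  have hr : 0 ≤ r := (norm_nonneg _).trans h
  refine ⟨j, b, hb, (pi_norm_le_iff_of_nonneg hr).mpr fun i => ?_⟩
  set g := x - (t • can a + UniformFun.toFun f.1 a) with hg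
  -- The term `t • can a` cancels, since it is parallel to the line along which one projects.
  have hgi : (transverse j f b - transverse j (Universe.const x hx) b) i = g j * b i - g i := by
    rw [Pi.sub_apply, transverse_apply, transverse_apply, hchart]
    change _ - (x i - x j * b i) = _
    simp only [hg, Pi.sub_apply, Pi.add_apply, Pi.smul_apply, smul_eq_mul, hj, hbdef]
    ring
  rw [hgi]
  refine (norm_sub_le_max _ _).trans (max_le ?_ ((norm_le_pi_norm g i).trans h))
  rw [norm_mul]
  exact (mul_le_of_le_one_right (norm_nonneg _) ((norm_le_pi_norm b i).trans hb)).trans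
    ((norm_le_pi_norm g j).trans h)

theorem continuous_apply_universe (a : ℙ K (Fin d → K)) :
    Continuous fun f : Universe K d => UniformFun.toFun f.1 a :=
  (UniformFun.uniformContinuous_eval (Fin d → K) a).continuous.comp continuous_subtype_val

end Charts

/-! ### Almost sure avoidance of a fixed point -/

section Measure

variable {K : Type*} [NontriviallyNormedField K] [IsUltrametricDist K] {d : ℕ}

theorem isClosed_norm_transverse_le (j : Fin d) (r : ℝ) :
    IsClosed {f : Universe K d | ∀ b, ‖b‖ ≤ 1 → ‖transverse j f b‖ ≤ r} := by
  simp only [Set.ofPred_forall]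
  refine isClosed_iInter fun b => isClosed_iInter fun _ => isClosed_le ?_ continuous_const
  refine continuous_norm.comp (continuous_pi fun i => ?_)
  have h := fun i => (continuous_apply i).comp (continuous_apply_universe (affineChart j b))
  exact (h i).sub ((h j).mul continuous_const)

/-- The pairs `(x, f)` such that `x` is at distance less than `r` from the Kakeya set of `f`. -/
def nearKakeya (K : Type*) [NontriviallyNormedField K] [IsUltrametricDist K] (d : ℕ) (r : ℝ) :
    Set ((Fin d → K) × Universe K d) :=
  ⋃ (a : ℙ K (Fin d → K)) (t ∈ 𝒪[K]), {p | ‖p.1 - (t • can a + UniformFun.toFun p.2.1 a)‖ < r}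

theorem mem_nearKakeya {r : ℝ} {x : Fin d → K} {f : Universe K d} :
    (x, f) ∈ nearKakeya K d r ↔
      ∃ a, ∃ t ∈ 𝒪[K], ‖x - (t • can a + UniformFun.toFun f.1 a)‖ < r := by
  simp [nearKakeya]

/-- The union over lines and parameters is uncountable, so measurability has to come from openness.
This is why open neighbourhoods replace the Kakeya set itself. -/
theorem isOpen_nearKakeya (r : ℝ) : IsOpen (nearKakeya K d r) := by
  refine isOpen_iUnion fun a => isOpen_biUnion fun t _ => isOpen_lt ?_ continuous_const
  exact continuous_norm.comp (continuous_fst.sub (continuous_const.add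
    ((continuous_apply_universe a).comp continuous_snd)))

variable [CompleteSpace K] [IsDiscreteValuationRing 𝒪[K]] [Finite 𝓀[K]]

theorem universeHaar_transverse_near_eq_zero (hd : 2 ≤ d) (j : Fin d) (g : Universe K d) :
    universeHaar K d {f | ∀ r > 0, ∃ b : {i // i ≠ j} → K, ‖b‖ ≤ 1 ∧
      ‖transverse j f b - transverse j g b‖ ≤ r} = 0 := by
  have := isAddHaarMeasure_universeHaar K d
  have := isProbabilityMeasure_universeHaar K d
  obtain ⟨D⟩ := nonempty_digitSystem K {i // i ≠ j}
  have : Nontrivial (Fin d) := Fin.nontrivial_iff_two_le.mpr hd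
  have : Nonempty {i // i ≠ j} := let ⟨i, hi⟩ := exists_ne j; ⟨⟨i, hi⟩⟩
  -- The hypothesis d ≥ 2 is essential here: for d = 1 the tree has a single branch and a single
  -- possible label, so it never dies.
  have hM : 2 ≤ Nat.card ({i // i ≠ j} → 𝓀[K]) := Finite.one_lt_card
  have hlim : Filter.Tendsto
      (fun n => ENNReal.ofReal (aliveProb (Nat.card ({i // i ≠ j} → 𝓀[K])) n))
      Filter.atTop (nhds 0) := by
    simpa using ENNReal.tendsto_ofReal (tendsto_aliveProb _ hM)
  refine le_antisymm (ge_of_tendsto' hlim fun n => ?_) zero_le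
  refine (measure_mono fun f hf => ?_).trans
    (measure_exists_near_le D (universeHaar K d) (transverse j)
    (isUnitLipschitz_transverse j) (fun φ hφ => exists_transverse_eq j hφ)
    (fun r => (isClosed_norm_transverse_le j r).measurableSet)
    (isUnitLipschitz_transverse j g) n)
  exact hf _ (pow_pos D.norm_π_pos n)

theorem universeHaar_iInter_nearKakeya (hd : 2 ≤ d) (x : Fin d → K) :
    universeHaar K d (Prod.mk x ⁻¹' ⋂ n : ℕ, nearKakeya K d (1 / (n + 1))) = 0 := by
  have : Nonempty (Fin d) := ⟨⟨0, by omega⟩⟩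
  by_cases hx : ‖x‖ ≤ 1
  · refine measure_mono_null (fun f hf => ?_) (measure_iUnion_null fun j =>
      universeHaar_transverse_near_eq_zero hd j (Universe.const x hx))
    by_contra hcon
    simp only [Set.mem_iUnion, Set.mem_ofPred_eq, not_exists, not_forall] at hcon
    choose r hr hcon using hcon
    -- There are finitely many charts, so one radius defeats all of them at once.
    obtain ⟨j₀, hj₀⟩ := Finite.exists_min r
    obtain ⟨n, hn⟩ := exists_nat_one_div_lt (hr j₀)
    obtain ⟨a, t, -, h⟩ := mem_nearKakeya.mp (Set.mem_iInter.mp hf n)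
    obtain ⟨j, b, hb, hjb⟩ := exists_norm_transverse_sub_le hx h.le
    exact hcon j b ⟨hb, hjb.trans (hn.le.trans (hj₀ j))⟩
  · convert measure_empty (μ := universeHaar K d)
    refine Set.eq_empty_of_forall_notMem fun f hf => hx ?_
    -- The index 0 gives radius 1, and the 1-neighbourhood of a Kakeya set stays in the unit ball.
    obtain ⟨a, t, ht, h⟩ := mem_nearKakeya.mp (Set.mem_iInter.mp hf 0)
    rw [← sub_add_cancel x (t • can a + UniformFun.toFun f.1 a)]
    refine (IsUltrametricDist.norm_add_le_max _ _).trans (max_le (by simpa using h.le) ?_)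
    refine (IsUltrametricDist.norm_add_le_max _ _).trans (max_le ?_ (f.2.1 a))
    rw [norm_smul, (can_spec a).1.1, mul_one]
    exact Valued.integer.mem_iff.mp ht

end Measure

end RandomKakeya

/-! ### Conclusion by Fubini -/

theorem mainTheorem2 (K : Type*) [NontriviallyNormedField K] [IsUltrametricDist K]
    [CompleteSpace K] [IsDiscreteValuationRing 𝒪[K]] [Finite 𝓀[K]]
    [MeasurableSpace K] [BorelSpace K] (d : ℕ) (hd : 2 ≤ d) :
    ∀ᵐ f ∂(RandomKakeya.universeHaar K d),
      RandomKakeya.spaceHaar K d (RandomKakeya.kakeyaSet f) = 0 := by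
  have := RandomKakeya.properSpace K
  have := RandomKakeya.isProbabilityMeasure_universeHaar K d
  have : SFinite (RandomKakeya.spaceHaar K d) := by
    unfold RandomKakeya.spaceHaar; infer_instance
  -- S consists of the pairs (x, f) with x at distance zero from N(f). It is a measurable set whose
  -- section at f contains N(f).
  set S := ⋂ n : ℕ, RandomKakeya.nearKakeya K d (1 / (n + 1)) with hS
  have hmeas : MeasurableSet S :=
    .iInter fun n => (RandomKakeya.isOpen_nearKakeya _).measurableSet
  have hprod : (RandomKakeya.spaceHaar K d).prod (RandomKakeya.universeHaar K d) S = 0 :=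
    (Measure.measure_prod_null hmeas).mpr
      (.of_forall fun x => RandomKakeya.universeHaar_iInter_nearKakeya hd x)
  have hswap : (RandomKakeya.universeHaar K d).prod (RandomKakeya.spaceHaar K d)
      (Prod.swap ⁻¹' S) = 0 := by
    rw [← Measure.map_apply measurable_swap hmeas, Measure.prod_swap, hprod]
  filter_upwards [Measure.measure_ae_null_of_prod_null hswap] with f hf
  refine measure_mono_null (fun x hx => ?_) hf
  obtain ⟨a, t, ht, rfl⟩ := Set.mem_iUnion.mp hx
  refine Set.mem_iInter.mpr fun n => RandomKakeya.mem_nearKakeya.mpr ⟨a, t, ht, ?_⟩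
  rw [sub_self, norm_zero]
  exact Nat.one_div_pos_of_nat
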